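/- Let $R$ be a left and right Noetherian ring (associative, with identity). A (left or right) module $G$ over a ring is called Gorenstein projective if there is an exact sequence of (not necessarily finitely generated) projective modules $\cdots \to P_1 \to P_0 \to P^0 \to P^1 \to \cdots$ that stays exact after applying $\operatorname{Hom}(-,Q)$ for every projective module $Q$, and such that $G \cong \operatorname{Im}(P_0 \to P^0)$. Write $(-)^* = \operatorname{Hom}_R(-,R)$, which sends left $R$-modules to right $R$-modules. Let $A$ be a finitely generated left $R$-module. A right $R$-module is called a transpose of $A$ if it is isomorphic to $\operatorname{Coker}(f^*\colon P_0^* \to P_1^*)$ for some exact sequence $P_1 \xrightarrow{f} P_0 \to A \to 0$ of left $R$-modules with $P_0, P_1$ finitely generated projective. It is called a Gorenstein transpose of $A$ if it is isomorphic to $\operatorname{Coker}(g^*\colon X_0^* \to X_1^*)$ for some exact sequence $X_1 \xrightarrow{g} X_0 \to A \to 0$ of left $R$-modules with $X_0, X_1$ finitely generated Gorenstein projective. Corollary 3.2. For every finitely generated Gorenstein projective right $R$-module $H$ and every transpose $\operatorname{Tr} A$ of $A$, the right $R$-module $H \oplus \operatorname{Tr} A$ is a Gorenstein transpose of $A$.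 -/

import Mathlib

universe u

/-!
Left `R`-modules are `Module R M`; right `R`-modules are `Module Rᵐᵒᵖ M`.
For a left `R`-module `M`, the dual `M →ₗ[R] R` carries Mathlib's right module structure,
given by `(φ r) x = φ x * r`.
-/

namespace GorTranspose

/-- Exact (unbounded) complexes of projective `R`-modules
`⋯ → P (-1) → P 0 → P 1 → ⋯` which stay exact under `Hom_R(-, Q)` for every projective
`R`-module `Q`. -/
structure CompleteProjRes (R : Type u) [Ring R] where
  /-- the terms of the complex -/
  P : ℤ → ModuleCat.{u} R
  /-- the differentials -/
  d : ∀ n : ℤ, P n →ₗ[R] P (n + 1)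
  projective : ∀ n : ℤ, Module.Projective R (P n)
  exact : ∀ n : ℤ, Function.Exact (d n) (d (n + 1))
  /-- exactness of `Hom(P (n+2), Q) → Hom(P (n+1), Q) → Hom(P n, Q)` at the middle term -/
  hom_exact : ∀ (Q : Type u) [AddCommGroup Q] [Module R Q], Module.Projective R Q → ∀ n : ℤ,
    Function.Exact (fun h : P (n + 1 + 1) →ₗ[R] Q => h ∘ₗ d (n + 1))
      (fun g : P (n + 1) →ₗ[R] Q => g ∘ₗ d n)

/-- `G` is Gorenstein projective: it is isomorphic to the image of a differential of an exact
complex of projectives that stays exact under `Hom_R(-, Q)` for all projective `Q`. -/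
def IsGorensteinProjective (R : Type u) [Ring R] (G : Type u) [AddCommGroup G] [Module R G] :
    Prop :=
  ∃ C : CompleteProjRes R, Nonempty (G ≃ₗ[R] LinearMap.range (C.d 0))

section Dual

variable {R : Type u} [Ring R] {M N : Type u} [AddCommGroup M] [Module R M]
  [AddCommGroup N] [Module R N]

/-- The dual `f^* : N^* → M^*`, `φ ↦ φ ∘ f`, of a map `f : M → N` of left `R`-modules, as a map
of right `R`-modules. -/
def dualMap (f : M →ₗ[R] N) : (N →ₗ[R] R) →ₗ[Rᵐᵒᵖ] (M →ₗ[R] R) where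
  toFun φ := φ ∘ₗ f
  map_add' _ _ := rfl
  map_smul' _ _ := rfl

/-- The cokernel of `f^* : N^* → M^*`, a right `R`-module. -/
abbrev CokerDual (f : M →ₗ[R] N) : Type u :=
  (M →ₗ[R] R) ⧸ LinearMap.range (dualMap f)

end Dual

/-- The right `R`-module `T` is (isomorphic to) a transpose of the left `R`-module `A`: there is
an exact sequence `P₁ → P₀ → A → 0` with `P₁`, `P₀` finitely generated projective, with first
map `f`, such that `T ≅ Coker f^*`. -/
def IsTranspose (R : Type u) [Ring R] (A : Type u) [AddCommGroup A] [Module R A]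
    (T : Type u) [AddCommGroup T] [Module Rᵐᵒᵖ T] : Prop :=
  ∃ (P₁ P₀ : ModuleCat.{u} R) (f : P₁ →ₗ[R] P₀) (p : P₀ →ₗ[R] A),
    Module.Finite R P₁ ∧ Module.Finite R P₀ ∧
    Module.Projective R P₁ ∧ Module.Projective R P₀ ∧
    Function.Exact f p ∧ Function.Surjective p ∧
    Nonempty (T ≃ₗ[Rᵐᵒᵖ] CokerDual f)

/-- The right `R`-module `T` is (isomorphic to) a Gorenstein transpose of the left `R`-module
`A`: there is an exact sequence `X₁ → X₀ → A → 0` with `X₁`, `X₀` finitely generated Gorenstein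
projective, with first map `g`, such that `T ≅ Coker g^*`. -/
def IsGorensteinTranspose (R : Type u) [Ring R] (A : Type u) [AddCommGroup A] [Module R A]
    (T : Type u) [AddCommGroup T] [Module Rᵐᵒᵖ T] : Prop :=
  ∃ (X₁ X₀ : ModuleCat.{u} R) (g : X₁ →ₗ[R] X₀) (p : X₀ →ₗ[R] A),
    Module.Finite R X₁ ∧ Module.Finite R X₀ ∧
    IsGorensteinProjective R X₁ ∧ IsGorensteinProjective R X₀ ∧
    Function.Exact g p ∧ Function.Surjective p ∧
    Nonempty (T ≃ₗ[Rᵐᵒᵖ] CokerDual g)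

end GorTranspose

/-!
Since `S = Rᵐᵒᵖ` is Noetherian, a finitely generated Gorenstein projective right module `H` has a
complete resolution by finite free modules. Indeed let `0 → M → Sⁿ → H → 0` be exact, or let
`H → Sⁿ` be a preenvelope with cokernel `N`, obtained by factoring a projective preenvelope of `H`
through a finite free module. Schanuel's lemma and its dual identify `M` and `N`, up to projective
summands, with the neighbouring images in the given complete resolution, so the construction can be
iterated in both directions.

The dual of a complex of finite free modules is a complete resolution as soon as both it and its
dual are exact. So if `0 → M → F → H → 0` is one of the short exact sequences above, then
`q : F^* → M^*` is a surjection from a finitely generated projective module onto a Gorenstein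
projective one, and `H ≅ F / M` is the cokernel of `q^*`, because `F ≅ F^**`. If `f : P₁ → P₀`
presents `A` then so does `q ⊕ f : F^* ⊕ P₁ → M^* ⊕ P₀`, and `Coker (q ⊕ f)^* ≅ H ⊕ Tr A`.
-/

namespace GorTranspose

section ShortExact

variable {S : Type*} [Ring S] {M P N M' P' N' L : Type*}
  [AddCommGroup M] [Module S M] [AddCommGroup P] [Module S P] [AddCommGroup N] [Module S N]
  [AddCommGroup M'] [Module S M'] [AddCommGroup P'] [Module S P'] [AddCommGroup N'] [Module S N']
  [AddCommGroup L] [Module S L]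

theorem exact_prodMap {f : M →ₗ[S] P} {g : P →ₗ[S] N} {f' : M' →ₗ[S] P'} {g' : P' →ₗ[S] N'}
    (h : Function.Exact f g) (h' : Function.Exact f' g') :
    Function.Exact (f.prodMap f') (g.prodMap g') := by
  rw [LinearMap.exact_iff] at h h' ⊢
  rw [LinearMap.ker_prodMap, LinearMap.range_prodMap, h, h']

theorem exact_prodMap_comp_snd {q : L →ₗ[S] N'} (hq : Function.Surjective q) {f : M →ₗ[S] P}
    {g : P →ₗ[S] N} (h : Function.Exact f g) :
    Function.Exact (q.prodMap f) (g ∘ₗ LinearMap.snd S N' P) := by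
  rw [LinearMap.exact_iff] at h ⊢
  rw [LinearMap.ker_comp, h, LinearMap.range_prodMap, LinearMap.range_eq_top.2 hq]
  ext
  simp

theorem exact_precomp_iff {u : M →ₗ[S] P} {v : P →ₗ[S] N} (huv : v ∘ₗ u = 0) :
    Function.Exact (fun h : N →ₗ[S] L => h ∘ₗ v) (fun g : P →ₗ[S] L => g ∘ₗ u) ↔
      ∀ g : P →ₗ[S] L, g ∘ₗ u = 0 → ∃ h : N →ₗ[S] L, h ∘ₗ v = g := by
  refine ⟨fun h g => (h g).1, fun h g => ⟨h g, ?_⟩⟩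
  rintro ⟨k, rfl⟩
  exact (LinearMap.comp_assoc u v k).trans (by rw [huv, LinearMap.comp_zero])

/-- `0 → M → P → N → 0` is a short exact sequence of modules, with maps `i` and `p`. -/
structure IsShortExact (i : M →ₗ[S] P) (p : P →ₗ[S] N) : Prop where
  injective : Function.Injective i
  exact : Function.Exact i p
  surjective : Function.Surjective p

theorem isShortExact_mkQ_range {i : M →ₗ[S] P} (hi : Function.Injective i) :
    IsShortExact i (LinearMap.range i).mkQ :=
  ⟨hi, LinearMap.exact_map_mkQ_range i, Submodule.mkQ_surjective _⟩

theorem isShortExact_ker_subtype {p : P →ₗ[S] N} (hp : Function.Surjective p) :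
    IsShortExact (LinearMap.ker p).subtype p :=
  ⟨Submodule.subtype_injective _, p.exact_subtype_ker_map, hp⟩

namespace IsShortExact

variable {i : M →ₗ[S] P} {p : P →ₗ[S] N} {i' : M' →ₗ[S] P'} {p' : P' →ₗ[S] N'}

theorem exists_lift (h : IsShortExact i p) {f : L →ₗ[S] P} (hf : p ∘ₗ f = 0) :
    ∃ g : L →ₗ[S] M, i ∘ₗ g = f := by
  have hrange (x : L) : f x ∈ LinearMap.range i := (h.exact _).1 (LinearMap.congr_fun hf x)
  refine ⟨(LinearEquiv.ofInjective i h.injective).symm ∘ₗ f.codRestrict _ hrange,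
    LinearMap.ext fun x => ?_⟩
  exact congrArg Subtype.val ((LinearEquiv.ofInjective i h.injective).apply_symm_apply _)

theorem exists_desc (h : IsShortExact i p) {f : P →ₗ[S] L} (hf : f ∘ₗ i = 0) :
    ∃ g : N →ₗ[S] L, g ∘ₗ p = f := by
  have hker : LinearMap.range i ≤ LinearMap.ker f := LinearMap.range_le_ker_iff.2 hf
  let e := h.exact.linearEquivOfSurjective h.surjective
  refine ⟨(LinearMap.range i).liftQ f hker ∘ₗ e.symm, LinearMap.ext fun x => ?_⟩
  have hx : e.symm (p x) = Submodule.Quotient.mk x := e.symm_apply_apply (Submodule.Quotient.mk x)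
  simp [hx]

theorem prodMap_id_left (h : IsShortExact i p) (F : Type*) [AddCommGroup F] [Module S F] :
    IsShortExact (i.prodMap (LinearMap.id : F →ₗ[S] F)) (p ∘ₗ LinearMap.fst S P F) where
  injective := h.injective.prodMap Function.injective_id
  exact x := by
    refine (h.exact x.1).trans ⟨?_, ?_⟩
    · rintro ⟨y, hy⟩
      exact ⟨(y, x.2), Prod.ext hy rfl⟩
    · rintro ⟨y, rfl⟩
      exact ⟨y.1, rfl⟩
  surjective := h.surjective.comp Prod.fst_surjective

theorem prodMap_id_right (h : IsShortExact i p) (F : Type*) [AddCommGroup F] [Module S F] :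
    IsShortExact (LinearMap.inl S P F ∘ₗ i) (p.prodMap (LinearMap.id : F →ₗ[S] F)) where
  injective := LinearMap.inl_injective.comp h.injective
  exact x := by
    refine (Prod.ext_iff.trans (and_congr_left' (h.exact x.1))).trans ⟨?_, ?_⟩
    · rintro ⟨⟨y, hy⟩, hx⟩
      exact ⟨y, Prod.ext hy hx.symm⟩
    · rintro ⟨y, rfl⟩
      exact ⟨⟨y, rfl⟩, rfl⟩
  surjective := h.surjective.prodMap Function.surjective_id

theorem comp_equiv_left (h : IsShortExact i p) (e : M' ≃ₗ[S] M) :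
    IsShortExact (i ∘ₗ e.toLinearMap) p where
  injective := h.injective.comp e.injective
  exact := (e.surjective.comp_exact_iff_exact).2 h.exact
  surjective := h.surjective

theorem equiv_comp_right (h : IsShortExact i p) (e : N ≃ₗ[S] N') :
    IsShortExact i (e.toLinearMap ∘ₗ p) where
  injective := h.injective
  exact := (e.injective.comp_exact_iff_exact).2 h.exact
  surjective := e.surjective.comp h.surjective

theorem exact_comp (h : IsShortExact i p) {q : L →ₗ[S] M} (hq : Function.Surjective q)
    {j : N →ₗ[S] N'} (hj : Function.Injective j) : Function.Exact (i ∘ₗ q) (j ∘ₗ p) :=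
  (hj.comp_exact_iff_exact (i := j)).2 ((hq.comp_exact_iff_exact).2 h.exact)

theorem nonempty_equiv_left (h : IsShortExact i p) {p' : P' →ₗ[S] N} (h' : IsShortExact i' p')
    (e : P ≃ₗ[S] P') (he : p' ∘ₗ e.toLinearMap = p) : Nonempty (M ≃ₗ[S] M') := by
  have hrange : (LinearMap.range i).map e.toLinearMap = LinearMap.range i' := by
    rw [← h.exact.linearMap_ker_eq, ← h'.exact.linearMap_ker_eq, ← he, LinearMap.ker_comp,
      Submodule.map_comap_eq_of_surjective e.surjective]
  exact ⟨LinearEquiv.ofInjective i h.injective ≪≫ₗ e.ofSubmodules _ _ hrange ≪≫ₗ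
    (LinearEquiv.ofInjective i' h'.injective).symm⟩

theorem nonempty_equiv_right (h : IsShortExact i p) {i' : M →ₗ[S] P'} (h' : IsShortExact i' p')
    (e : P ≃ₗ[S] P') (he : e.toLinearMap ∘ₗ i = i') : Nonempty (N ≃ₗ[S] N') := by
  have hrange : (LinearMap.range i).map e.toLinearMap = LinearMap.range i' := by
    rw [← he, LinearMap.range_comp]
  exact ⟨(h.exact.linearEquivOfSurjective h.surjective).symm ≪≫ₗ
    Submodule.Quotient.equiv _ _ e hrange ≪≫ₗ h'.exact.linearEquivOfSurjective h'.surjective⟩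

/-- Schanuel's lemma. -/
theorem nonempty_prod_equiv_prod [Module.Projective S P] [Module.Projective S P']
    (h : IsShortExact i p) {p' : P' →ₗ[S] N} (h' : IsShortExact i' p') :
    Nonempty ((M × P') ≃ₗ[S] (M' × P)) := by
  obtain ⟨a, ha⟩ := Module.projective_lifting_property p' p h'.surjective
  obtain ⟨b, hb⟩ := Module.projective_lifting_property p p' h.surjective
  -- The equivalence `(x, y) ↦ (y + a (x - b y), x - b y)` lifts the identity of `N`.
  let e : (P × P') ≃ₗ[S] (P' × P) :=
    LinearEquiv.prodComm S P P' ≪≫ₗ (LinearEquiv.refl S P').skewProd (LinearEquiv.refl S P) (-b)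
      ≪≫ₗ LinearEquiv.prodComm S P' P ≪≫ₗ
      (LinearEquiv.refl S P).skewProd (LinearEquiv.refl S P') a ≪≫ₗ LinearEquiv.prodComm S P P'
  have ha' (x : P) : p' (a x) = p x := LinearMap.congr_fun ha x
  have hb' (y : P') : p (b y) = p' y := LinearMap.congr_fun hb y
  exact (h.prodMap_id_left P').nonempty_equiv_left (h'.prodMap_id_left P) e
    (LinearMap.ext fun _ => by simp [e, ha', hb'])

end IsShortExact

end ShortExact

section ProjectivePreenvelope

variable {S : Type u} [Ring S] {M P N M' P' N' : Type u}
  [AddCommGroup M] [Module S M] [AddCommGroup P] [Module S P] [AddCommGroup N] [Module S N]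
  [AddCommGroup M'] [Module S M'] [AddCommGroup P'] [Module S P'] [AddCommGroup N'] [Module S N']

/-- `i : M → P` is a projective preenvelope: `P` is projective and every map from `M` to a
projective module extends along `i`. It need not be injective. -/
structure IsProjectivePreenvelope (i : M →ₗ[S] P) : Prop where
  projective : Module.Projective S P
  exists_extension : ∀ (Q : Type u) [AddCommGroup Q] [Module S Q] [Module.Projective S Q]
    (φ : M →ₗ[S] Q), ∃ ψ : P →ₗ[S] Q, ψ ∘ₗ i = φ

namespace IsProjectivePreenvelope

variable {i : M →ₗ[S] P}

theorem prodMap_id (h : IsProjectivePreenvelope i) (F : Type u) [AddCommGroup F] [Module S F]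
    [Module.Projective S F] :
    IsProjectivePreenvelope (i.prodMap (LinearMap.id : F →ₗ[S] F)) where
  projective := have := h.projective; inferInstance
  exists_extension Q _ _ _ φ := by
    obtain ⟨ψ, hψ⟩ := h.exists_extension Q (φ ∘ₗ LinearMap.inl S M F)
    refine ⟨ψ.coprod (φ ∘ₗ LinearMap.inr S M F), LinearMap.prod_ext ?_ ?_⟩
    · rw [← hψ]; ext; simp [Prod.mk_zero_zero]
    · ext; simp

theorem of_comp [Module.Projective S P] {f : P →ₗ[S] P'} (h : IsProjectivePreenvelope (f ∘ₗ i)) :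
    IsProjectivePreenvelope i where
  projective := inferInstance
  exists_extension Q _ _ _ φ :=
    let ⟨ψ, hψ⟩ := h.exists_extension Q φ
    ⟨ψ ∘ₗ f, hψ⟩

theorem comp_of_split (h : IsProjectivePreenvelope i) {s : M' →ₗ[S] M} {r : M →ₗ[S] M'}
    (hs : r ∘ₗ s = LinearMap.id) : IsProjectivePreenvelope (i ∘ₗ s) where
  projective := h.projective
  exists_extension Q _ _ _ φ := by
    obtain ⟨ψ, hψ⟩ := h.exists_extension Q (φ ∘ₗ r)
    exact ⟨ψ, by rw [← LinearMap.comp_assoc, hψ, LinearMap.comp_assoc, hs, LinearMap.comp_id]⟩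

theorem comp_equiv (h : IsProjectivePreenvelope i) (e : M' ≃ₗ[S] M) :
    IsProjectivePreenvelope (i ∘ₗ e.toLinearMap) :=
  h.comp_of_split e.symm_comp

/-- Both preenvelope conditions amount to the vanishing of `Ext¹(N, Q)` for projective `Q`. -/
theorem of_isShortExact [Module.Projective S P'] (hi : IsProjectivePreenvelope i) {p : P →ₗ[S] N}
    (h : IsShortExact i p) {i' : M' →ₗ[S] P'} {p' : P' →ₗ[S] N} (h' : IsShortExact i' p') :
    IsProjectivePreenvelope i' where
  projective := inferInstance
  exists_extension Q _ _ _ φ := by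
    have := hi.projective
    obtain ⟨a, ha⟩ := Module.projective_lifting_property p' p h'.surjective
    obtain ⟨b, hb⟩ := Module.projective_lifting_property p p' h.surjective
    have comp_apply_left (x : M) : p (i x) = 0 := h.exact.apply_apply_eq_zero x
    have comp_apply_right (x : M') : p' (i' x) = 0 := h'.exact.apply_apply_eq_zero x
    have ha' (x : P) : p' (a x) = p x := LinearMap.congr_fun ha x
    have hb' (y : P') : p (b y) = p' y := LinearMap.congr_fun hb y
    obtain ⟨α, hα⟩ := h'.exists_lift (f := a ∘ₗ i) (by ext; simp [ha', comp_apply_left])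
    obtain ⟨β, hβ⟩ := h.exists_lift (f := b ∘ₗ i') (by ext; simp [hb', comp_apply_right])
    -- `a ∘ b` lifts the identity of `N`, so it differs from the identity of `P'` by some `i' ∘ c`.
    obtain ⟨c, hc⟩ := h'.exists_lift (f := LinearMap.id - a ∘ₗ b) (by ext; simp [ha', hb'])
    have hid : α ∘ₗ β + c ∘ₗ i' = LinearMap.id := LinearMap.ext fun x => h'.injective <| by
      have hα' (y : M) : i' (α y) = a (i y) := LinearMap.congr_fun hα y
      have hβ' : i (β x) = b (i' x) := LinearMap.congr_fun hβ x
      have hc' (y : P') : i' (c y) = y - a (b y) := LinearMap.congr_fun hc y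
      simp [hα', hβ', hc']
    obtain ⟨ψ, hψ⟩ := hi.exists_extension Q (φ ∘ₗ α)
    refine ⟨ψ ∘ₗ b + φ ∘ₗ c, ?_⟩
    calc (ψ ∘ₗ b + φ ∘ₗ c) ∘ₗ i'
        = ψ ∘ₗ (b ∘ₗ i') + φ ∘ₗ (c ∘ₗ i') := rfl
      _ = (ψ ∘ₗ i) ∘ₗ β + φ ∘ₗ (c ∘ₗ i') := by rw [← hβ]; rfl
      _ = φ ∘ₗ (α ∘ₗ β + c ∘ₗ i') := by rw [hψ, LinearMap.comp_add]; rfl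
      _ = φ := by rw [hid, LinearMap.comp_id]

/-- The dual of Schanuel's lemma. -/
theorem nonempty_prod_equiv_prod (hi : IsProjectivePreenvelope i) {p : P →ₗ[S] N}
    (h : IsShortExact i p) {i' : M →ₗ[S] P'} (hi' : IsProjectivePreenvelope i')
    {p' : P' →ₗ[S] N'} (h' : IsShortExact i' p') : Nonempty ((N × P') ≃ₗ[S] (N' × P)) := by
  have := hi.projective
  have := hi'.projective
  obtain ⟨a, ha⟩ := hi.exists_extension P' i'
  obtain ⟨b, hb⟩ := hi'.exists_extension P i
  -- The equivalence `(x, y) ↦ (y + a x, x - b (y + a x))` extends the identity of `M`.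
  let e : (P × P') ≃ₗ[S] (P' × P) :=
    (LinearEquiv.refl S P).skewProd (LinearEquiv.refl S P') a ≪≫ₗ LinearEquiv.prodComm S P P' ≪≫ₗ
      (LinearEquiv.refl S P').skewProd (LinearEquiv.refl S P) (-b)
  have ha' (x : M) : a (i x) = i' x := LinearMap.congr_fun ha x
  have hb' (x : M) : b (i' x) = i x := LinearMap.congr_fun hb x
  exact (h.prodMap_id_right P').nonempty_equiv_right (h'.prodMap_id_right P) e
    (LinearMap.ext fun _ => by simp [e, ha', hb'])

end IsProjectivePreenvelope

end ProjectivePreenvelope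

section Factorization

theorem exists_factorization_pi {S M Q : Type*} [Ring S] [AddCommGroup M] [Module S M]
    [AddCommGroup Q] [Module S Q] [Module.Finite S M] [Module.Projective S Q] (k : M →ₗ[S] Q) :
    ∃ (n : ℕ) (a : M →ₗ[S] (Fin n → S)) (b : (Fin n → S) →ₗ[S] Q),
      b ∘ₗ a = k ∧ LinearMap.ker k ≤ LinearMap.ker a := by
  obtain ⟨s, hs⟩ := Module.projective_def'.1 ‹Module.Projective S Q›
  obtain ⟨c, hc⟩ := (LinearMap.finsuppLinearMap_bijective_of_moduleFinite S M S Q ℤ).2 (s ∘ₗ k)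
  have hc' (x : M) (q : Q) : c q x = s (k x) q := DFunLike.congr_fun (LinearMap.congr_fun hc x) q
  let e := c.support.equivFin
  refine ⟨c.support.card, LinearMap.pi fun j => c (e.symm j),
    Fintype.linearCombination S fun j => (e.symm j : Q), LinearMap.ext fun x => ?_, fun x hx => ?_⟩
  · have hsupp : (s (k x)).support ⊆ c.support := fun q hq => by
      rw [Finsupp.mem_support_iff, ← hc'] at hq
      exact Finsupp.mem_support_iff.2 fun h => hq (by rw [h, LinearMap.zero_apply])
    calc ∑ j, c (e.symm j) x • (e.symm j : Q)
        = ∑ q ∈ c.support, s (k x) q • q := by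
          rw [e.symm.sum_comp fun q : c.support => c q x • (q : Q),
            c.support.sum_coe_sort fun q => c q x • q]
          simp only [hc']
      _ = Finsupp.linearCombination S id (s (k x)) :=
          ((Finsupp.linearCombination_apply S _).trans <|
            Finsupp.sum_of_support_subset _ hsupp _ fun q _ => zero_smul S q).symm
      _ = k x := LinearMap.congr_fun hs (k x)
  · rw [LinearMap.mem_ker] at hx ⊢
    funext j
    simp [hc', hx]

theorem IsProjectivePreenvelope.exists_pi {S M P : Type u} [Ring S] [AddCommGroup M] [Module S M]
    [AddCommGroup P] [Module S P] [Module.Finite S M] {j : M →ₗ[S] P}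
    (hj : IsProjectivePreenvelope j) (hinj : Function.Injective j) :
    ∃ (n : ℕ) (a : M →ₗ[S] (Fin n → S)), IsProjectivePreenvelope a ∧ Function.Injective a := by
  have := hj.projective
  obtain ⟨n, a, b, rfl, -⟩ := exists_factorization_pi j
  exact ⟨n, a, hj.of_comp, Function.Injective.of_comp hinj⟩

end Factorization

section Complexes

variable {S : Type u} [Ring S]

namespace CompleteProjRes

theorem exists_comp_eq (C : CompleteProjRes S) {Q : Type u} [AddCommGroup Q] [Module S Q]
    [Module.Projective S Q] {n : ℤ} {g : C.P (n + 1) →ₗ[S] Q} (hg : g ∘ₗ C.d n = 0) :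
    ∃ h : C.P (n + 1 + 1) →ₗ[S] Q, h ∘ₗ C.d (n + 1) = g :=
  (C.hom_exact Q inferInstance n g).1 hg

/-- The direct sum of two complete projective resolutions. -/
def prod (C D : CompleteProjRes S) : CompleteProjRes S where
  P n := ModuleCat.of S (C.P n × D.P n)
  d n := (C.d n).prodMap (D.d n)
  projective n :=
    have := C.projective n
    have := D.projective n
    inferInstanceAs (Module.Projective S (C.P n × D.P n))
  exact n := exact_prodMap (C.exact n) (D.exact n)
  hom_exact Q _ _ _ n := by
    have hzero : (C.d (n + 1)).prodMap (D.d (n + 1)) ∘ₗ (C.d n).prodMap (D.d n) = 0 :=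
      (exact_prodMap (C.exact n) (D.exact n)).linearMap_comp_eq_zero
    refine (exact_precomp_iff hzero).2 fun g hg => ?_
    obtain ⟨h, hh⟩ := C.exists_comp_eq (g := g ∘ₗ LinearMap.inl S _ _)
      (LinearMap.ext fun x => by simpa using LinearMap.congr_fun hg (x, 0))
    obtain ⟨k, hk⟩ := D.exists_comp_eq (g := g ∘ₗ LinearMap.inr S _ _)
      (LinearMap.ext fun x => by simpa using LinearMap.congr_fun hg (0, x))
    refine ⟨h.coprod k, LinearMap.prod_ext ?_ ?_⟩
    · rw [← hh]; ext; simp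
    · rw [← hk]; ext; simp

theorem nonempty_range_prod (C D : CompleteProjRes S) (n : ℤ) :
    Nonempty ((LinearMap.range (C.d n) × LinearMap.range (D.d n)) ≃ₗ[S]
      LinearMap.range ((C.prod D).d n)) := by
  let f := (LinearMap.range (C.d n)).subtype.prodMap (LinearMap.range (D.d n)).subtype
  have hf : Function.Injective f := Subtype.val_injective.prodMap Subtype.val_injective
  have hrange : LinearMap.range f = LinearMap.range ((C.d n).prodMap (D.d n)) := by
    rw [LinearMap.range_prodMap, LinearMap.range_prodMap, Submodule.range_subtype,
      Submodule.range_subtype]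
  exact ⟨LinearEquiv.ofInjective f hf ≪≫ₗ LinearEquiv.ofEq _ _ hrange⟩

/-- The contractible complex `⋯ → F × F → F × F → ⋯` with differential `(x, y) ↦ (0, x)`, all of
whose cycles are isomorphic to the projective module `F`. -/
def ofProjective (F : Type u) [AddCommGroup F] [Module S F] [Module.Projective S F] :
    CompleteProjRes S where
  P _ := ModuleCat.of S (F × F)
  d _ := LinearMap.inr S F F ∘ₗ LinearMap.fst S F F
  projective _ := inferInstanceAs (Module.Projective S (F × F))
  exact _ := LinearMap.exact_iff.2 <| by
    rw [LinearMap.ker_comp_of_ker_eq_bot _ (LinearMap.ker_eq_bot.2 LinearMap.inr_injective),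
      LinearMap.range_comp_of_range_eq_top _ (LinearMap.range_eq_top.2 Prod.fst_surjective),
      LinearMap.ker_fst]
  hom_exact Q _ _ _ _ := (exact_precomp_iff (by ext <;> simp)).2 fun g hg =>
    ⟨g ∘ₗ LinearMap.inl S F F ∘ₗ LinearMap.snd S F F, LinearMap.prod_ext (by ext; simp) <| by
      ext x
      simpa [Prod.mk_zero_zero] using (LinearMap.congr_fun hg (x, 0)).symm⟩

theorem nonempty_range_ofProjective (F : Type u) [AddCommGroup F] [Module S F]
    [Module.Projective S F] (n : ℤ) :
    Nonempty (F ≃ₗ[S] LinearMap.range ((ofProjective (S := S) F).d n)) := by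
  have hrange : LinearMap.range (LinearMap.inr S F F ∘ₗ LinearMap.fst S F F) =
      LinearMap.range (LinearMap.inr S F F) :=
    LinearMap.range_comp_of_range_eq_top _ (LinearMap.range_eq_top.2 Prod.fst_surjective)
  exact ⟨LinearEquiv.ofInjective _ LinearMap.inr_injective ≪≫ₗ LinearEquiv.ofEq _ _ hrange.symm⟩

theorem isShortExact (C : CompleteProjRes S) (n : ℤ) :
    IsShortExact (LinearMap.range (C.d n)).subtype (C.d (n + 1)).rangeRestrict where
  injective := Submodule.subtype_injective _
  exact := LinearMap.exact_iff.2 <| by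
    rw [LinearMap.ker_rangeRestrict, Submodule.range_subtype, (C.exact n).linearMap_ker_eq]
  surjective := LinearMap.surjective_rangeRestrict _

theorem isProjectivePreenvelope (C : CompleteProjRes S) (n : ℤ) :
    IsProjectivePreenvelope (LinearMap.range (C.d n)).subtype where
  projective := C.projective _
  exists_extension Q _ _ _ φ := by
    obtain ⟨m, rfl⟩ : ∃ m, n = m + 1 := ⟨n - 1, by ring⟩
    have hzero : (C.d (m + 1)).rangeRestrict ∘ₗ C.d m = 0 := LinearMap.ext fun x =>
      Subtype.ext ((C.exact m).apply_apply_eq_zero x)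
    obtain ⟨ψ, hψ⟩ := C.exists_comp_eq (g := φ ∘ₗ (C.d (m + 1)).rangeRestrict)
      (by rw [LinearMap.comp_assoc, hzero, LinearMap.comp_zero])
    refine ⟨ψ, (LinearMap.cancel_right (C.d (m + 1)).surjective_rangeRestrict).1 ?_⟩
    rw [← hψ]
    rfl

end CompleteProjRes

variable {G G' : Type u} [AddCommGroup G] [Module S G] [AddCommGroup G'] [Module S G']

theorem IsGorensteinProjective.prod (hG : IsGorensteinProjective S G)
    (hG' : IsGorensteinProjective S G') : IsGorensteinProjective S (G × G') := by
  obtain ⟨C, ⟨e⟩⟩ := hG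
  obtain ⟨D, ⟨e'⟩⟩ := hG'
  obtain ⟨eCD⟩ := C.nonempty_range_prod D 0
  exact ⟨C.prod D, ⟨e.prodCongr e' ≪≫ₗ eCD⟩⟩

theorem isGorensteinProjective_of_projective [Module.Projective S G] :
    IsGorensteinProjective S G :=
  ⟨CompleteProjRes.ofProjective G, CompleteProjRes.nonempty_range_ofProjective G 0⟩

/-- `G` is isomorphic to the image of some differential of a complete projective resolution.
Allowing every degree, instead of degree `0` only, spares reindexing the resolution when passing to
its neighbouring images. -/
def IsSyzygy (S : Type u) [Ring S] (G : Type u) [AddCommGroup G] [Module S G] : Prop :=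
  ∃ (C : CompleteProjRes S) (n : ℤ), Nonempty (G ≃ₗ[S] LinearMap.range (C.d n))

namespace IsSyzygy

theorem of_equiv (hG : IsSyzygy S G) (e : G' ≃ₗ[S] G) : IsSyzygy S G' :=
  let ⟨C, n, ⟨f⟩⟩ := hG
  ⟨C, n, ⟨e ≪≫ₗ f⟩⟩

theorem prod (hG : IsSyzygy S G) (F : Type u) [AddCommGroup F] [Module S F]
    [Module.Projective S F] : IsSyzygy S (G × F) := by
  obtain ⟨C, n, ⟨e⟩⟩ := hG
  obtain ⟨eF⟩ := CompleteProjRes.nonempty_range_ofProjective (S := S) F n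
  obtain ⟨eCF⟩ := C.nonempty_range_prod (CompleteProjRes.ofProjective F) n
  exact ⟨_, n, ⟨e.prodCongr eF ≪≫ₗ eCF⟩⟩

theorem exists_right (hG : IsSyzygy S G) :
    ∃ (P N : ModuleCat.{u} S) (i : G →ₗ[S] P) (p : P →ₗ[S] N),
      IsSyzygy S N ∧ IsShortExact i p ∧ IsProjectivePreenvelope i := by
  obtain ⟨C, n, ⟨e⟩⟩ := hG
  exact ⟨C.P (n + 1), ModuleCat.of S (LinearMap.range (C.d (n + 1))), _, _,
    ⟨C, n + 1, ⟨LinearEquiv.refl _ _⟩⟩, (C.isShortExact n).comp_equiv_left e,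
    (C.isProjectivePreenvelope n).comp_equiv e⟩

theorem exists_left (hG : IsSyzygy S G) :
    ∃ (M P : ModuleCat.{u} S) (i : M →ₗ[S] P) (p : P →ₗ[S] G),
      IsSyzygy S M ∧ IsShortExact i p ∧ IsProjectivePreenvelope i := by
  obtain ⟨C, n, ⟨e⟩⟩ := hG
  obtain ⟨m, rfl⟩ : ∃ m, n = m + 1 := ⟨n - 1, by ring⟩
  exact ⟨ModuleCat.of S (LinearMap.range (C.d m)), C.P (m + 1), _, _,
    ⟨C, m, ⟨LinearEquiv.refl _ _⟩⟩, (C.isShortExact m).equiv_comp_right e.symm,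
    C.isProjectivePreenvelope m⟩

end IsSyzygy

end Complexes

section FiniteFreeChain

theorem exists_int_chain {α : Type*} {r : α → α → Prop} (hr : ∀ a, ∃ b, r a b)
    (hl : ∀ b, ∃ a, r a b) (x : α) : ∃ t : ℤ → α, t 0 = x ∧ ∀ k, r (t k) (t (k + 1)) := by
  choose f hf using hr
  choose g hg using hl
  refine ⟨fun k => match k with
    | Int.ofNat k => f^[k] x
    | Int.negSucc k => g^[k + 1] x, rfl, ?_⟩
  rintro (k | k)
  · change r (f^[k] x) (f^[k + 1] x)
    rw [Function.iterate_succ_apply']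
    exact hf _
  · cases k with
    | zero => exact hg x
    | succ k =>
      have : Int.negSucc (k + 1) + 1 = Int.negSucc k := by omega
      rw [this]
      change r (g^[k + 1 + 1] x) (g^[k + 1] x)
      rw [Function.iterate_succ_apply' g (k + 1)]
      exact hg _

variable {S : Type u} [Ring S]

/-- `M` is finitely generated and becomes a syzygy of a complete projective resolution after adding
a projective module. Unlike `IsSyzygy`, this is stable under taking kernels of surjections from, and
cokernels of injective preenvelopes into, finite free modules. -/
def IsStableSyzygy (S : Type u) [Ring S] (M : Type u) [AddCommGroup M] [Module S M] : Prop :=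
  Module.Finite S M ∧ ∃ F : ModuleCat.{u} S, Module.Projective S F ∧ IsSyzygy S (M × F)

/-- There is a short exact sequence `0 → M → Sⁿ → N → 0` with `n` finite whose first map is a
projective preenvelope. -/
def IsFiniteFreeExtension (S : Type u) [Ring S] (M N : Type u) [AddCommGroup M] [Module S M]
    [AddCommGroup N] [Module S N] : Prop :=
  ∃ (n : ℕ) (i : M →ₗ[S] (Fin n → S)) (p : (Fin n → S) →ₗ[S] N),
    IsShortExact i p ∧ IsProjectivePreenvelope i

variable {G : Type u} [AddCommGroup G] [Module S G]

theorem IsGorensteinProjective.isStableSyzygy [Module.Finite S G]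
    (hG : IsGorensteinProjective S G) : IsStableSyzygy S G :=
  let ⟨C, e⟩ := hG
  ⟨inferInstance, ModuleCat.of S PUnit.{u + 1}, inferInstanceAs (Module.Projective S PUnit.{u + 1}),
    IsSyzygy.prod ⟨C, 0, e⟩ PUnit⟩

theorem IsStableSyzygy.exists_right (hG : IsStableSyzygy S G) :
    ∃ N : ModuleCat.{u} S, IsStableSyzygy S N ∧ IsFiniteFreeExtension S G N := by
  obtain ⟨hfin, F, hF, hGF⟩ := hG
  obtain ⟨P, N', j, q, hN', hjq, hj⟩ := hGF.exists_right
  have hj_inl : IsProjectivePreenvelope (j ∘ₗ LinearMap.inl S G F) :=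
    hj.comp_of_split (LinearMap.fst_comp_inl S G F)
  obtain ⟨n, a, ha, ha_inj⟩ := hj_inl.exists_pi (hjq.injective.comp LinearMap.inl_injective)
  have haN := isShortExact_mkQ_range ha_inj
  obtain ⟨e⟩ := (ha.prodMap_id F).nonempty_prod_equiv_prod (haN.prodMap_id_left F) hj hjq
  have := hj.projective
  exact ⟨ModuleCat.of S ((Fin n → S) ⧸ LinearMap.range a),
    ⟨inferInstanceAs (Module.Finite S ((Fin n → S) ⧸ LinearMap.range a)), P, hj.projective,
      (hN'.prod ((Fin n → S) × F)).of_equiv e⟩, n, a, _, haN, ha⟩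

theorem IsStableSyzygy.exists_left [IsNoetherianRing S] (hG : IsStableSyzygy S G) :
    ∃ M : ModuleCat.{u} S, IsStableSyzygy S M ∧ IsFiniteFreeExtension S M G := by
  obtain ⟨hfin, F, hF, hGF⟩ := hG
  obtain ⟨K, P, j, q, hK, hjq, hj⟩ := hGF.exists_left
  obtain ⟨n, p, hp⟩ := Module.Finite.exists_fin' S G
  have hpG := isShortExact_ker_subtype hp
  have hi : IsProjectivePreenvelope (LinearMap.ker p).subtype :=
    (hj.of_isShortExact hjq (hpG.prodMap_id_right F)).of_comp
  have := hj.projective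
  obtain ⟨e⟩ := (hpG.prodMap_id_right F).nonempty_prod_equiv_prod hjq
  exact ⟨ModuleCat.of S (LinearMap.ker p),
    ⟨inferInstanceAs (Module.Finite S (LinearMap.ker p)), P, hj.projective,
      (hK.prod ((Fin n → S) × F)).of_equiv e⟩, n, _, p, hpG, hi⟩

/-- Short exact sequences `0 → obj (k + 1) → S ^ rank k → obj k → 0`, one for every integer `k`,
whose first maps are projective preenvelopes. Splicing them gives an exact complex of finite free
modules, whose differentials lower the degree. -/
structure FiniteFreeChain (S : Type u) [Ring S] where
  /-- the images of the spliced differentials -/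
  obj : ℤ → ModuleCat.{u} S
  /-- the ranks of the free modules -/
  rank : ℤ → ℕ
  /-- the inclusion of an image into the next free module -/
  ι : ∀ k, obj (k + 1) →ₗ[S] (Fin (rank k) → S)
  /-- the projection of a free module onto an image -/
  π : ∀ k, (Fin (rank k) → S) →ₗ[S] obj k
  isShortExact : ∀ k, IsShortExact (ι k) (π k)
  isProjectivePreenvelope : ∀ k, IsProjectivePreenvelope (ι k)

theorem IsGorensteinProjective.exists_finiteFreeChain [IsNoetherianRing S] [Module.Finite S G]
    (hG : IsGorensteinProjective S G) :
    ∃ c : FiniteFreeChain S, Nonempty (G ≃ₗ[S] c.obj 0) := by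
  obtain ⟨t, ht₀, ht⟩ := exists_int_chain
    (α := {M : ModuleCat.{u} S // IsStableSyzygy S M})
    (r := fun N M => IsFiniteFreeExtension S M.1 N.1)
    (fun N => let ⟨M, hM, hMN⟩ := N.2.exists_left; ⟨⟨M, hM⟩, hMN⟩)
    (fun M => let ⟨N, hN, hMN⟩ := M.2.exists_right; ⟨⟨N, hN⟩, hMN⟩)
    ⟨ModuleCat.of S G, hG.isStableSyzygy⟩
  choose n i p hip hi using ht
  have e : Nonempty (G ≃ₗ[S] (t 0).1) := by
    rw [ht₀]
    exact ⟨LinearEquiv.refl S G⟩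
  exact ⟨⟨fun k => (t k).1, n, i, p, hip, hi⟩, e⟩

end FiniteFreeChain

section Dual

variable {R : Type u} [Ring R]

section Codual

variable {M N F : Type u} [AddCommGroup M] [Module Rᵐᵒᵖ M] [AddCommGroup N] [Module Rᵐᵒᵖ N]
  [AddCommGroup F] [Module Rᵐᵒᵖ F]

/-- The dual `f^* : N^* → M^*` of a map `f : M → N` of right `R`-modules, as a map of left
`R`-modules. -/
abbrev codualMap (f : M →ₗ[Rᵐᵒᵖ] N) : (N →ₗ[Rᵐᵒᵖ] R) →ₗ[R] (M →ₗ[Rᵐᵒᵖ] R) :=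
  f.lcomp R R

/-- The evaluation map `M → M^**` of a right `R`-module `M`. -/
def evalDual (M : Type u) [AddCommGroup M] [Module Rᵐᵒᵖ M] :
    M →ₗ[Rᵐᵒᵖ] ((M →ₗ[Rᵐᵒᵖ] R) →ₗ[R] R) where
  toFun := LinearMap.applyₗ' R
  map_add' := map_add _
  map_smul' r x := LinearMap.ext fun φ => φ.map_smul r x

@[simp]
theorem evalDual_apply (x : M) (φ : M →ₗ[Rᵐᵒᵖ] R) : evalDual M x φ = φ x := rfl

theorem dualMap_codualMap_comp_evalDual (f : M →ₗ[Rᵐᵒᵖ] N) :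
    dualMap (codualMap (R := R) f) ∘ₗ evalDual M = evalDual N ∘ₗ f := rfl

theorem evalDual_injective_of_injective {f : M →ₗ[Rᵐᵒᵖ] N} (hf : Function.Injective f)
    (hN : Function.Injective (evalDual (R := R) N)) :
    Function.Injective (evalDual (R := R) M) :=
  .of_comp (f := dualMap (codualMap f)) (hN.comp hf)

variable (R) in
theorem projective_mulOpposite_self : Module.Projective Rᵐᵒᵖ R :=
  .of_equiv (MulOpposite.opLinearEquiv Rᵐᵒᵖ).symm

theorem IsShortExact.codual {i : M →ₗ[Rᵐᵒᵖ] F} {p : F →ₗ[Rᵐᵒᵖ] N} (h : IsShortExact i p)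
    (hi : IsProjectivePreenvelope i) :
    IsShortExact (codualMap (R := R) p) (codualMap i) where
  injective := LinearMap.lcomp_injective_of_surjective p h.surjective
  exact φ := by
    refine ⟨fun hφ => h.exists_desc hφ, ?_⟩
    rintro ⟨ψ, rfl⟩
    exact (LinearMap.comp_assoc _ _ _).trans
      (by rw [h.exact.linearMap_comp_eq_zero, LinearMap.comp_zero])
  surjective :=
    have := projective_mulOpposite_self R
    hi.exists_extension R

theorem exact_dualMap_codualMap {f : M →ₗ[Rᵐᵒᵖ] F} {g : F →ₗ[Rᵐᵒᵖ] N} (h : Function.Exact f g)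
    (hM : Function.Bijective (evalDual (R := R) M)) (hF : Function.Bijective (evalDual (R := R) F))
    (hN : Function.Bijective (evalDual (R := R) N)) :
    Function.Exact (dualMap (codualMap (R := R) f)) (dualMap (codualMap g)) :=
  Function.Exact.of_ladder_linearEquiv_of_exact (e₁ := .ofBijective _ hM)
    (e₂ := .ofBijective _ hF) (e₃ := .ofBijective _ hN)
    (dualMap_codualMap_comp_evalDual f) (dualMap_codualMap_comp_evalDual g) h

theorem IsShortExact.nonempty_equiv_cokerDual {i : M →ₗ[Rᵐᵒᵖ] F} {p : F →ₗ[Rᵐᵒᵖ] N}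
    (h : IsShortExact i p) (hF : Function.Bijective (evalDual (R := R) F))
    (hN : Function.Injective (evalDual (R := R) N)) :
    Nonempty (N ≃ₗ[Rᵐᵒᵖ] CokerDual (codualMap (R := R) i)) := by
  let e := LinearEquiv.ofBijective _ hF
  have hrange : (LinearMap.range i).map e.toLinearMap =
      LinearMap.range (dualMap (codualMap (R := R) i)) := by
    refine le_antisymm ?_ ?_
    · rintro _ ⟨_, ⟨x, rfl⟩, rfl⟩
      exact ⟨evalDual M x, LinearMap.congr_fun (dualMap_codualMap_comp_evalDual i) x⟩
    · rintro _ ⟨g, rfl⟩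
      obtain ⟨v, hv⟩ := hF.2 (dualMap (codualMap (R := R) i) g)
      refine ⟨v, (h.exact v).1 (hN (LinearMap.ext fun φ => ?_)), hv⟩
      calc φ (p v) = g (codualMap i (φ ∘ₗ p)) := LinearMap.congr_fun hv (φ ∘ₗ p)
        _ = g 0 := congrArg g (LinearMap.ext fun x => by simp [h.exact.apply_apply_eq_zero x])
        _ = evalDual N 0 φ := by rw [map_zero, map_zero, LinearMap.zero_apply]
  exact ⟨(h.exact.linearEquivOfSurjective h.surjective).symm ≪≫ₗ
    Submodule.Quotient.equiv _ _ e hrange⟩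

end Codual

section FiniteFree

variable (R) (n : ℕ)

/-- The basis of the left `R`-module dual to a finite free right `R`-module. -/
noncomputable def dualBasis : Module.Basis (Fin n) R ((Fin n → Rᵐᵒᵖ) →ₗ[Rᵐᵒᵖ] R) :=
  (Pi.basisFun R (Fin n)).map ((Pi.basisFun Rᵐᵒᵖ (Fin n)).constr R)

theorem dualBasis_apply (j : Fin n) (v : Fin n → Rᵐᵒᵖ) :
    dualBasis R n j v = MulOpposite.unop (v j) := by
  simp [dualBasis, Module.Basis.constr_apply_fintype, Pi.single_apply]

theorem evalDual_bijective : Function.Bijective (evalDual (R := R) (Fin n → Rᵐᵒᵖ)) := by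
  refine ⟨fun v w h => funext fun j => MulOpposite.unop_injective ?_, fun g =>
    ⟨fun j => MulOpposite.op (g (dualBasis R n j)), (dualBasis R n).ext fun j => ?_⟩⟩
  · simpa only [evalDual_apply, dualBasis_apply] using LinearMap.congr_fun h (dualBasis R n j)
  · rw [evalDual_apply, dualBasis_apply, MulOpposite.unop_op]

instance : Module.Projective R ((Fin n → Rᵐᵒᵖ) →ₗ[Rᵐᵒᵖ] R) := .of_basis (dualBasis R n)

instance : Module.Finite R ((Fin n → Rᵐᵒᵖ) →ₗ[Rᵐᵒᵖ] R) := .of_basis (dualBasis R n)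

end FiniteFree

theorem exists_comp_eq_of_exact_dualMap {L M N Q : Type u} [AddCommGroup L] [Module R L]
    [AddCommGroup M] [Module R M] [Module.Finite R M] [AddCommGroup N] [Module R N]
    [AddCommGroup Q] [Module R Q] [Module.Projective R Q] {u : L →ₗ[R] M} {v : M →ₗ[R] N}
    (h : Function.Exact (dualMap v) (dualMap u)) {k : M →ₗ[R] Q} (hk : k ∘ₗ u = 0) :
    ∃ l : N →ₗ[R] Q, l ∘ₗ v = k := by
  obtain ⟨n, a, b, rfl, hker⟩ := exists_factorization_pi k
  have hau (x : L) : a (u x) = 0 := hker (LinearMap.congr_fun hk x)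
  choose l hl using fun j : Fin n => (h (LinearMap.proj (φ := fun _ => R) j ∘ₗ a)).1
    (LinearMap.ext fun x => congrFun (hau x) j)
  exact ⟨b ∘ₗ LinearMap.pi l, LinearMap.ext fun x =>
    congrArg b (funext fun j => LinearMap.congr_fun (hl j) x)⟩

namespace FiniteFreeChain

variable (c : FiniteFreeChain Rᵐᵒᵖ) (k : ℤ)

theorem exact_splice : Function.Exact (c.ι (k + 1) ∘ₗ c.π (k + 1 + 1)) (c.ι k ∘ₗ c.π (k + 1)) :=
  (c.isShortExact (k + 1)).exact_comp (c.isShortExact (k + 1 + 1)).surjective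
    (c.isShortExact k).injective

theorem isShortExact_codualMap :
    IsShortExact (codualMap (R := R) (c.π k)) (codualMap (c.ι k)) :=
  (c.isShortExact k).codual (c.isProjectivePreenvelope k)

theorem exact_codualMap_splice : Function.Exact
    (codualMap (R := R) (c.ι k ∘ₗ c.π (k + 1)))
    (codualMap (c.ι (k + 1) ∘ₗ c.π (k + 1 + 1))) :=
  (c.isShortExact_codualMap (k + 1)).exact_comp (c.isShortExact_codualMap k).surjective
    (c.isShortExact_codualMap (k + 1 + 1)).injective

/-- The dual of the complex of finite free right modules obtained by splicing the chain. -/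
def dual : CompleteProjRes R where
  P k := ModuleCat.of R ((Fin (c.rank k) → Rᵐᵒᵖ) →ₗ[Rᵐᵒᵖ] R)
  d k := codualMap (c.ι k ∘ₗ c.π (k + 1))
  projective k := inferInstanceAs (Module.Projective R ((Fin (c.rank k) → Rᵐᵒᵖ) →ₗ[Rᵐᵒᵖ] R))
  exact k := c.exact_codualMap_splice k
  hom_exact _ _ _ _ k :=
    (exact_precomp_iff (c.exact_codualMap_splice k).linearMap_comp_eq_zero).2 fun _ =>
      exists_comp_eq_of_exact_dualMap (exact_dualMap_codualMap (c.exact_splice k)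
        (evalDual_bijective R _) (evalDual_bijective R _) (evalDual_bijective R _))

theorem isGorensteinProjective_dual_obj :
    IsGorensteinProjective R (c.obj 1 →ₗ[Rᵐᵒᵖ] R) := by
  have hrange : LinearMap.range (c.dual.d 0) = LinearMap.range (codualMap (R := R) (c.π 1)) :=
    LinearMap.range_comp_of_range_eq_top (f := codualMap (R := R) (c.ι 0)) (codualMap (c.π 1))
      (LinearMap.range_eq_top.2 (c.isShortExact_codualMap 0).surjective)
  exact ⟨c.dual, ⟨LinearEquiv.ofInjective _ (c.isShortExact_codualMap 1).injective ≪≫ₗ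
    LinearEquiv.ofEq _ _ hrange.symm⟩⟩

theorem evalDual_obj_injective : Function.Injective (evalDual (R := R) (c.obj k)) := by
  obtain ⟨m, rfl⟩ : ∃ m, k = m + 1 := ⟨k - 1, by ring⟩
  exact evalDual_injective_of_injective (c.isShortExact m).injective (evalDual_bijective R _).1

theorem nonempty_obj_equiv_cokerDual :
    Nonempty (c.obj k ≃ₗ[Rᵐᵒᵖ] CokerDual (codualMap (R := R) (c.ι k))) :=
  (c.isShortExact k).nonempty_equiv_cokerDual (evalDual_bijective R _) (c.evalDual_obj_injective k)

end FiniteFreeChain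

end Dual

section GorensteinTranspose

variable {R : Type u} [Ring R]

/-- A finitely generated Gorenstein projective right module is a Gorenstein transpose of `0`, by a
presentation whose source is projective. -/
theorem IsGorensteinProjective.exists_equiv_cokerDual [IsNoetherianRing Rᵐᵒᵖ] {H : Type u}
    [AddCommGroup H] [Module Rᵐᵒᵖ H] [Module.Finite Rᵐᵒᵖ H]
    (hH : IsGorensteinProjective Rᵐᵒᵖ H) :
    ∃ (Q K : ModuleCat.{u} R) (q : Q →ₗ[R] K), Module.Finite R Q ∧ Module.Projective R Q ∧
      IsGorensteinProjective R K ∧ Function.Surjective q ∧ Nonempty (H ≃ₗ[Rᵐᵒᵖ] CokerDual q) := by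
  obtain ⟨c, ⟨e⟩⟩ := hH.exists_finiteFreeChain
  obtain ⟨e'⟩ := c.nonempty_obj_equiv_cokerDual 0
  exact ⟨ModuleCat.of R ((Fin (c.rank 0) → Rᵐᵒᵖ) →ₗ[Rᵐᵒᵖ] R), ModuleCat.of R (c.obj 1 →ₗ[Rᵐᵒᵖ] R),
    codualMap (c.ι 0), inferInstanceAs (Module.Finite R ((Fin (c.rank 0) → Rᵐᵒᵖ) →ₗ[Rᵐᵒᵖ] R)),
    inferInstanceAs (Module.Projective R ((Fin (c.rank 0) → Rᵐᵒᵖ) →ₗ[Rᵐᵒᵖ] R)),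
    c.isGorensteinProjective_dual_obj, (c.isShortExact_codualMap 0).surjective, ⟨e ≪≫ₗ e'⟩⟩

variable {M N M' N' : Type u} [AddCommGroup M] [Module R M] [AddCommGroup N] [Module R N]
  [AddCommGroup M'] [Module R M'] [AddCommGroup N'] [Module R N']

theorem nonempty_cokerDual_prodMap_equiv (f : M →ₗ[R] N) (g : M' →ₗ[R] N') :
    Nonempty ((CokerDual f × CokerDual g) ≃ₗ[Rᵐᵒᵖ] CokerDual (f.prodMap g)) := by
  let eM := LinearMap.coprodEquiv Rᵐᵒᵖ (R := R) (M := M) (M₂ := M') (M₃ := R)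
  let eN := LinearMap.coprodEquiv Rᵐᵒᵖ (R := R) (M := N) (M₂ := N') (M₃ := R)
  have h : Function.Exact ((dualMap f).prodMap (dualMap g))
      ((LinearMap.range (dualMap f)).mkQ.prodMap (LinearMap.range (dualMap g)).mkQ) :=
    exact_prodMap (LinearMap.exact_map_mkQ_range _) (LinearMap.exact_map_mkQ_range _)
  have hsurj := (LinearMap.range (dualMap f)).mkQ_surjective.prodMap
    (LinearMap.range (dualMap g)).mkQ_surjective
  have hcomm : eM.toLinearMap ∘ₗ (dualMap f).prodMap (dualMap g) =
      dualMap (f.prodMap g) ∘ₗ eN.toLinearMap := by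
    ext <;> simp [eM, eN, dualMap]
  have hrange : (LinearMap.range ((dualMap f).prodMap (dualMap g))).map eM.toLinearMap =
      LinearMap.range (dualMap (f.prodMap g)) := by
    rw [← LinearMap.range_comp, hcomm, LinearMap.range_comp_of_range_eq_top _ eN.range]
  exact ⟨(h.linearEquivOfSurjective hsurj).symm ≪≫ₗ Submodule.Quotient.equiv _ _ eM hrange⟩

end GorensteinTranspose

end GorTranspose

theorem corollary3p2_general (R : Type u) [Ring R] [IsNoetherianRing Rᵐᵒᵖ]
    (A : Type u) [AddCommGroup A] [Module R A]
    (H : Type u) [AddCommGroup H] [Module Rᵐᵒᵖ H] [Module.Finite Rᵐᵒᵖ H]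
    (hH : GorTranspose.IsGorensteinProjective Rᵐᵒᵖ H)
    (T : Type u) [AddCommGroup T] [Module Rᵐᵒᵖ T]
    (hT : GorTranspose.IsTranspose R A T) :
    GorTranspose.IsGorensteinTranspose R A (H × T) := by
  obtain ⟨Q, K, q, hQfin, hQ, hK, hq, ⟨eH⟩⟩ := hH.exists_equiv_cokerDual
  obtain ⟨P₁, P₀, f, p, hP₁fin, hP₀fin, hP₁, hP₀, hfp, hp, ⟨eT⟩⟩ := hT
  obtain ⟨e⟩ := GorTranspose.nonempty_cokerDual_prodMap_equiv q f
  have : Module.Finite R K := .of_surjective q hq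
  exact ⟨ModuleCat.of R (Q × P₁), ModuleCat.of R (K × P₀), q.prodMap f,
    p ∘ₗ LinearMap.snd R K P₀,
    inferInstanceAs (Module.Finite R (Q × P₁)), inferInstanceAs (Module.Finite R (K × P₀)),
    GorTranspose.isGorensteinProjective_of_projective (G := Q × P₁),
    hK.prod GorTranspose.isGorensteinProjective_of_projective,
    GorTranspose.exact_prodMap_comp_snd hq hfp, hp.comp Prod.snd_surjective,
    ⟨eH.prodCongr eT ≪≫ₗ e⟩⟩

theorem corollary3p2 (R : Type u) [Ring R] [IsNoetherianRing R] [IsNoetherianRing Rᵐᵒᵖ]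
    (A : Type u) [AddCommGroup A] [Module R A] [Module.Finite R A]
    (H : Type u) [AddCommGroup H] [Module Rᵐᵒᵖ H] [Module.Finite Rᵐᵒᵖ H]
    (hH : GorTranspose.IsGorensteinProjective Rᵐᵒᵖ H)
    (T : Type u) [AddCommGroup T] [Module Rᵐᵒᵖ T]
    (hT : GorTranspose.IsTranspose R A T) :
    GorTranspose.IsGorensteinTranspose R A (H × T) :=
  corollary3p2_general R A H hH T hT
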